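/- Let $\Omega$ be a locally compact Hausdorff space, and let $C_0(\Omega)$ be the $C^\star$-algebra of continuous functions $f:\Omega\to\mathbb{C}$ such that $\{\omega\in\Omega : |f(\omega)|\ge\varepsilon\}$ is compact for every $\varepsilon>0$. Regard $C_0(\Omega)$ as a $C^\star$-subalgebra of its second dual $C_0(\Omega)^{**}$ via the canonical embedding, where $C_0(\Omega)^{**}$ carries its canonical $W^\star$-algebra structure. A projection $p=p^\star=p^2$ in $C_0(\Omega)^{**}$ is called open if there is an increasing net $(a_\alpha)$ of positive elements of $C_0(\Omega)$ that converges to $p$ in the weak$^*$ topology of $C_0(\Omega)^{**}$. Then every projection in $C_0(\Omega)^{**}$ is open if and only if $\Omega$ is discrete. In this case: 1. every $f\in C_0(\Omega)$ vanishes outside an at most countable subset of $\Omega$; 2. $C_0(\Omega)$ is a norm-closed two-sided ideal in $C_0(\Omega)^{**}$; 3. $C_0(\Omega)^{**}$ is the multiplier algebra of $C_0(\Omega)$, that is, there is an isometric $^\star$-isomorphism of $C_0(\Omega)^{**}$ onto the multiplier algebra $M(C_0(\Omega))$ that restricts to the canonical embedding $C_0(\Omega)\to M(C_0(\Omega))$;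 4. if moreover $\Omega$ is compact, then $C_0(\Omega)=C(\Omega)$ is isometrically $^\star$-isomorphic to $\ell^\infty_n=\mathbb{C}^n$ (with the maximum norm) for some finite $n\in\mathbb{N}$ (where $n=0$ if $\Omega$ is empty). -/

import Mathlib

open scoped ZeroAtInfty MultiplierAlgebra Topology
open Filter

namespace CStarBidual

universe u

section Bidual

variable {A : Type u} [NonUnitalCStarAlgebra A]

/-- The second dual `A**` of a C⋆-algebra `A`, as a Banach space. -/
abbrev Bidual (A : Type u) [NonUnitalCStarAlgebra A] : Type u :=
  StrongDual ℂ (StrongDual ℂ A)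

/-- The canonical inclusion of `A` into `A**`, evaluation at `a`. -/
noncomputable abbrev incl : A →ₗᵢ[ℂ] Bidual A :=
  NormedSpace.inclusionInDoubleDualLi ℂ

/-- The functional `f · a : b ↦ f (a b)` on `A`, as a bounded bilinear map in `(f, a)`. -/
noncomputable def dualAct : StrongDual ℂ A →L[ℂ] A →L[ℂ] StrongDual ℂ A :=
  ((ContinuousLinearMap.compL ℂ A (A →L[ℂ] A) (A →L[ℂ] ℂ)).flip
    (ContinuousLinearMap.mul ℂ A)).comp (ContinuousLinearMap.compL ℂ A A ℂ)

theorem dualAct_apply (f : StrongDual ℂ A) (a b : A) : dualAct f a b = f (a * b) := rfl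

/-- For `F ∈ A**`, the bounded operator `f ↦ F · f` on `A*`, where `(F · f) a = F (f · a)`. -/
noncomputable def bidualAct (F : Bidual A) : StrongDual ℂ A →L[ℂ] StrongDual ℂ A :=
  (ContinuousLinearMap.compL ℂ A (StrongDual ℂ A) ℂ F).comp dualAct

theorem bidualAct_apply (F : Bidual A) (f : StrongDual ℂ A) (a : A) :
    bidualAct F f a = F (dualAct f a) := rfl

/-- The canonical product of `A**` (the Arens product): `(F G) f = F (G · f)`. It extends the
product of `A`, and it is the product of the W⋆-algebra `A**`. -/
noncomputable instance instMulBidual : Mul (Bidual A) where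
  mul F G := ContinuousLinearMap.comp F (bidualAct G)

theorem mul_apply (F G : Bidual A) (f : StrongDual ℂ A) : (F * G) f = F (bidualAct G f) := rfl

/-- The adjoint functional `f⋆ : a ↦ conj (f (a⋆))` of a functional `f` on `A`. -/
noncomputable def dualStar (f : StrongDual ℂ A) : StrongDual ℂ A :=
  LinearMap.mkContinuous
    { toFun := fun a => star (f (star a))
      map_add' := fun a b => by simp
      map_smul' := fun c a => by simp } ‖f‖
    (fun a => by simpa using f.le_opNorm (star a))

theorem dualStar_apply (f : StrongDual ℂ A) (a : A) : dualStar f a = star (f (star a)) := rfl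

theorem norm_dualStar_le (f : StrongDual ℂ A) : ‖dualStar f‖ ≤ ‖f‖ :=
  LinearMap.mkContinuous_norm_le _ (norm_nonneg f) _

/-- The canonical involution of `A**`: `F⋆ f = conj (F (f⋆))`. It extends the involution of `A`
and is weak⋆-continuous. -/
noncomputable instance instStarBidual : Star (Bidual A) where
  star F := LinearMap.mkContinuous
    { toFun := fun f => star (F (dualStar f))
      map_add' := fun f g => by
        have h : dualStar (f + g) = dualStar f + dualStar g := by
          ext a; simp [dualStar_apply]
        simp [h]
      map_smul' := fun c f => by
        have h : dualStar (c • f) = star c • dualStar f := by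
          ext a; simp [dualStar_apply]
        simp [h] } ‖F‖
    (fun f => by
      simpa using F.le_opNorm_of_le (norm_dualStar_le f))

theorem star_apply (F : Bidual A) (f : StrongDual ℂ A) : (star F) f = star (F (dualStar f)) := rfl

theorem incl_mul (a b : A) : incl (a * b) = incl a * incl b := rfl

theorem incl_star (a : A) : incl (star a) = star (incl a) := by
  ext f
  exact (star_star (f (star a))).symm

/-- `x` is a positive element of the C⋆-algebra `A`. -/
def IsPos (x : A) : Prop := ∃ b : A, x = star b * b

/-- A projection `p` of `A**` (`p = p⋆ = p²`) is open if it is the weak⋆ limit of an increasing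
net of positive elements of `A`. (The elements of the net, ordered by the order of `A`, are again
such a net, so index sets in the universe of `A` suffice.) -/
def IsOpenProjection (p : Bidual A) : Prop :=
  IsStarProjection p ∧
    ∃ (ι : Type u) (_ : Preorder ι) (_ : IsDirectedOrder ι) (_ : Nonempty ι) (a : ι → A),
      (∀ i, IsPos (a i)) ∧ (∀ i j, i ≤ j → IsPos (a j - a i)) ∧
        Tendsto (fun i => StrongDual.toWeakDual (incl (a i))) atTop
          (𝓝 (StrongDual.toWeakDual p))

/-- `A` is a (norm-closed two-sided) ideal in `A**`. -/
def IsIdealInBidual (A : Type u) [NonUnitalCStarAlgebra A] : Prop :=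
  IsClosed (Set.range (incl : A → Bidual A)) ∧
    ∀ (F : Bidual A) (a : A),
      F * incl a ∈ Set.range (incl : A → Bidual A) ∧
        incl a * F ∈ Set.range (incl : A → Bidual A)

/-- `A**` is the multiplier algebra of `A`: there is an (isometric) ⋆-isomorphism of `A**` onto
the multiplier algebra that restricts to the canonical embedding of `A` into it. -/
def BidualIsMultiplierAlgebra (A : Type u) [NonUnitalCStarAlgebra A] : Prop :=
  ∃ Φ : Bidual A ≃⋆ₐ[ℂ] 𝓜(ℂ, A),
    Isometry Φ ∧ ∀ a : A, Φ (incl a) = (a : 𝓜(ℂ, A))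

end Bidual

end CStarBidual

/-! Everything is tested on the evaluations `evalAt x`, which stay multiplicative on the bidual
(`mul_evalAt`). If all projections are open, take for each point `x` a projection `p` whose values
at the evaluations form the indicator of `{x}` (`exists_isStarProjection_atom`). An increasing net
of positive functions tending to `p` vanishes off `x`, and some member is nonzero at `x`. Its
nonvanishing set is `{x}`, which is therefore open. If `Ω` is discrete, then `C₀(Ω, ℂ)` is `c₀(Ω)`,
its dual is `ℓ¹(Ω)` (`hasSum_smul_evalAt`) and its bidual is `ℓ^∞(Ω)` (`bidual_ext`,
`norm_bidual_le`, `exists_bidual_evalAt_eq`). A projection is then a 0-1 function, the weak⋆ limit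
of its finite partial sums, and the multipliers of `c₀(Ω)` are the bounded functions acting
pointwise. -/

namespace CStarBidual

/-! ### Point evaluations as characters of the bidual; open projections. -/

section Evaluation

variable {Ω : Type*} [TopologicalSpace Ω]

theorem norm_apply_le (a : C₀(Ω, ℂ)) (x : Ω) : ‖a x‖ ≤ ‖a‖ :=
  a.toBCF.norm_coe_le_norm x

theorem norm_le_of_forall {a : C₀(Ω, ℂ)} {C : ℝ} (hC : 0 ≤ C) (h : ∀ x, ‖a x‖ ≤ C) : ‖a‖ ≤ C :=
  (BoundedContinuousFunction.norm_le (f := a.toBCF) hC).2 h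

/-- Evaluation at a point, as a bounded functional on `C₀(Ω, ℂ)`. -/
noncomputable def evalAt (x : Ω) : StrongDual ℂ C₀(Ω, ℂ) :=
  LinearMap.mkContinuous
    { toFun := fun a => a x
      map_add' := fun _ _ => rfl
      map_smul' := fun _ _ => rfl } 1
    (fun a => by simpa using norm_apply_le a x)

theorem evalAt_apply (x : Ω) (a : C₀(Ω, ℂ)) : evalAt x a = a x := rfl

theorem norm_evalAt_le (x : Ω) : ‖evalAt x‖ ≤ 1 :=
  LinearMap.mkContinuous_norm_le _ zero_le_one _

theorem incl_evalAt (a : C₀(Ω, ℂ)) (x : Ω) : incl a (evalAt x) = a x := rfl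

/-- Since `evalAt x` is multiplicative on functions, it is a common eigenvector of all the operators
`bidualAct F`. -/
theorem bidualAct_evalAt (F : Bidual C₀(Ω, ℂ)) (x : Ω) :
    bidualAct F (evalAt x) = F (evalAt x) • evalAt x := by
  ext a
  have h : dualAct (evalAt x) a = a x • evalAt x := by
    ext b; rfl
  rw [bidualAct_apply, h, map_smul]
  simp [evalAt_apply, mul_comm]

theorem mul_evalAt (F G : Bidual C₀(Ω, ℂ)) (x : Ω) :
    (F * G) (evalAt x) = F (evalAt x) * G (evalAt x) := by
  rw [mul_apply, bidualAct_evalAt, map_smul, smul_eq_mul, mul_comm]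

theorem dualStar_evalAt (x : Ω) : dualStar (evalAt x) = evalAt x := by
  ext a
  simp [dualStar_apply, evalAt_apply]

theorem star_evalAt (F : Bidual C₀(Ω, ℂ)) (x : Ω) :
    (star F) (evalAt x) = star (F (evalAt x)) := by
  rw [star_apply, dualStar_evalAt]

theorem norm_evalAt_le_norm (F : Bidual C₀(Ω, ℂ)) (x : Ω) : ‖F (evalAt x)‖ ≤ ‖F‖ := by
  simpa using F.le_opNorm_of_le (norm_evalAt_le x)

theorem IsPos.exists_nonneg {a : C₀(Ω, ℂ)} (ha : IsPos a) (x : Ω) : ∃ r : ℝ, 0 ≤ r ∧ a x = r := by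
  obtain ⟨b, rfl⟩ := ha
  refine ⟨‖b x‖ ^ 2, by positivity, ?_⟩
  rw [ZeroAtInftyContinuousMap.mul_apply, ZeroAtInftyContinuousMap.star_apply,
    RCLike.star_def, RCLike.conj_mul]
  simp

theorem eq_zero_of_evalAt_eq_zero {p : Bidual C₀(Ω, ℂ)} {ι : Type*} [Preorder ι]
    [IsDirectedOrder ι] [Nonempty ι] {a : ι → C₀(Ω, ℂ)} (hpos : ∀ i, IsPos (a i))
    (hmono : ∀ i j, i ≤ j → IsPos (a j - a i))
    (hlim : Tendsto (fun i => StrongDual.toWeakDual (incl (a i))) atTop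
      (𝓝 (StrongDual.toWeakDual p)))
    {x : Ω} (hx : p (evalAt x) = 0) (i : ι) : a i x = 0 := by
  have hl : Tendsto (fun j => (a j x).re) atTop (𝓝 0) := by
    have h := ((WeakDual.eval_continuous (evalAt x)).tendsto _).comp hlim
    have h' := (Complex.continuous_re.tendsto _).comp h
    have e : Complex.re (StrongDual.toWeakDual p (evalAt x)) = 0 := by
      have : StrongDual.toWeakDual p (evalAt x) = 0 := hx
      simp [this]
    rw [e] at h'
    exact h'
  -- An increasing net stays below its limit, which is 0 at `x`.
  have hle : (a i x).re ≤ 0 := by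
    refine ge_of_tendsto hl ((eventually_ge_atTop i).mono fun j hj => ?_)
    obtain ⟨r, hr, h⟩ := (hmono i j hj).exists_nonneg x
    have := congrArg Complex.re h
    simp at this
    linarith
  obtain ⟨r, hr, h⟩ := (hpos i).exists_nonneg x
  rw [h] at hle ⊢
  simp at hle
  simp [le_antisymm hle hr]

theorem isOpen_singleton_of_isOpenProjection {p : Bidual C₀(Ω, ℂ)} (hp : IsOpenProjection p)
    {x : Ω} (hx : p (evalAt x) = 1) (hne : ∀ y, y ≠ x → p (evalAt y) = 0) : IsOpen {x} := by
  obtain ⟨-, ι, _, _, _, a, hpos, hmono, hlim⟩ := hp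
  -- If every member vanished at `x`, the weak⋆ limit would take the value 0 there instead of 1.
  obtain ⟨i, hi⟩ : ∃ i, a i x ≠ 0 := by
    by_contra! h
    have hl := ((WeakDual.eval_continuous (evalAt x)).tendsto _).comp hlim
    have hc : Tendsto (fun _ : ι => (0 : ℂ)) atTop (𝓝 1) := by
      rw [← hx]
      refine hl.congr fun i => ?_
      exact h i
    exact zero_ne_one (tendsto_nhds_unique tendsto_const_nhds hc)
  have hs : {x} = (a i) ⁻¹' {0}ᶜ := by
    ext y
    by_cases hy : y = x
    · simp [hy, hi]
    · simp [hy, eq_zero_of_evalAt_eq_zero hpos hmono hlim (hne y hy) i]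
  rw [hs]
  exact isOpen_compl_singleton.preimage (map_continuous (a i))

end Evaluation

/-! ### Atomic projections from shrinking bump functions. -/

section Atom

variable {Ω : Type*} [TopologicalSpace Ω] [LocallyCompactSpace Ω] [T2Space Ω]

theorem exists_bump (x : Ω) (U : TopologicalSpace.OpenNhdsOf x) :
    ∃ b : C₀(Ω, ℂ), b x = 1 ∧ (∀ y ∉ U, b y = 0) ∧ (∀ y, ‖b y‖ ≤ 1) ∧ star b = b := by
  obtain ⟨g, hg1, hgc, hgU, hg⟩ := exists_continuousMap_one_of_isCompact_subset_isOpen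
    (isCompact_singleton (x := x)) U.isOpen (Set.singleton_subset_iff.2 U.mem)
  have hc : HasCompactSupport fun y => (g y : ℂ) :=
    HasCompactSupport.comp_left (g := fun r : ℝ => (r : ℂ)) hgc Complex.ofReal_zero
  refine ⟨⟨⟨fun y => (g y : ℂ), by fun_prop⟩, hc.is_zero_at_infty⟩, ?_, ?_, ?_, ?_⟩
  · have : g x = 1 := hg1 rfl
    show (g x : ℂ) = 1
    simp [this]
  · intro y hy
    have : g y = 0 := image_eq_zero_of_notMem_tsupport fun h => hy (hgU h)
    show (g y : ℂ) = 0
    simp [this]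
  · intro y
    show ‖(g y : ℂ)‖ ≤ 1
    rw [Complex.norm_real, Real.norm_of_nonneg (hg y).1]
    exact (hg y).2
  · ext y
    exact Complex.conj_ofReal _

/-- Every point of `Ω` carries a projection of the bidual that is its indicator function. -/
theorem exists_isStarProjection_atom (x : Ω) :
    ∃ p : Bidual C₀(Ω, ℂ), IsStarProjection p ∧ p (evalAt x) = 1 ∧
      ∀ y, y ≠ x → p (evalAt y) = 0 := by
  choose b hb1 hb0 hb hbs using exists_bump x
  have hbn (U) : ‖b U‖ ≤ 1 := norm_le_of_forall zero_le_one (hb U)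
  -- Neighbourhoods are ordered by inclusion, so `atBot` means shrinking to `x`. An ultrafilter
  -- makes the bumps converge weak⋆, by Banach–Alaoglu.
  let l : Ultrafilter (TopologicalSpace.OpenNhdsOf x) := Ultrafilter.of atBot
  have hl : (l : Filter (TopologicalSpace.OpenNhdsOf x)) ≤ atBot := Ultrafilter.of_le _
  obtain ⟨q, -, hq⟩ := isCompact_iff_ultrafilter_le_nhds.1
    (WeakDual.isCompact_closedBall (𝕜 := ℂ) (E := StrongDual ℂ C₀(Ω, ℂ)) 0 1)
    (l.map fun U => StrongDual.toWeakDual (incl (b U))) (by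
      refine le_principal_iff.2 (Filter.mem_map.2 (univ_mem' fun U => ?_))
      exact mem_closedBall_zero_iff.2 ((incl.norm_map (b U)).trans_le (hbn U)))
  let p : Bidual C₀(Ω, ℂ) := WeakDual.toStrongDual q
  have hp (f : StrongDual ℂ C₀(Ω, ℂ)) : Tendsto (fun U => f (b U)) l (𝓝 (p f)) :=
    ((WeakDual.eval_continuous f).tendsto q).comp hq
  have hpx : p (evalAt x) = 1 :=
    tendsto_nhds_unique (hp _) (tendsto_const_nhds.congr fun U => (hb1 U).symm)
  -- This identity makes `p` a minimal idempotent: with `p (evalAt x) = 1` it gives `p * p = p`.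
  have hact (f) : bidualAct p f = p f • evalAt x := by
    ext a
    have h1 : Tendsto (fun U => f (a * b U)) l (𝓝 (bidualAct p f a)) := hp (dualAct f a)
    have h2 : Tendsto (fun U => a x * f (b U)) l (𝓝 (a x * p f)) := (hp f).const_mul _
    -- On a small `U` the function `a` is within `ε / 2` of `a x`; off `U` the bump is zero.
    have h3 : Tendsto (fun U => a * b U - a x • b U) l (𝓝 0) := by
      rw [NormedAddGroup.tendsto_nhds_zero]
      intro ε hε
      obtain ⟨V, hVs, hV, hxV⟩ := mem_nhds_iff.1
        ((map_continuous a).continuousAt.preimage_mem_nhds (Metric.ball_mem_nhds (a x) (half_pos hε)))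
      refine ((eventually_le_atBot (⟨⟨V, hV⟩, hxV⟩ :
        TopologicalSpace.OpenNhdsOf x)).filter_mono hl).mono fun U hU => ?_
      refine (norm_le_of_forall (half_pos hε).le fun y => ?_).trans_lt (half_lt_self hε)
      show ‖a y * b U y - a x * b U y‖ ≤ ε / 2
      by_cases hy : y ∈ U
      · have h := hVs (hU hy)
        rw [Set.mem_preimage, mem_ball_iff_norm] at h
        rw [← sub_mul, norm_mul]
        exact (mul_le_of_le_one_right (norm_nonneg _) (hb U y)).trans h.le
      · simp [hb0 U y hy, (half_pos hε).le]
    have h4 : Tendsto (fun U => f (a * b U)) l (𝓝 (a x * p f)) := by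
      have h := ((f.continuous.tendsto 0).comp h3).add h2
      rw [map_zero, zero_add] at h
      refine h.congr fun U => ?_
      simp
    rw [tendsto_nhds_unique h1 h4]
    simp [evalAt_apply, mul_comm]
  refine ⟨p, ⟨?_, ?_⟩, hpx, fun y hy => ?_⟩
  · ext f
    rw [mul_apply, hact, map_smul, hpx, smul_eq_mul, mul_one]
  · ext f
    rw [star_apply]
    have h := (continuous_star.tendsto _).comp (hp (dualStar f))
    refine tendsto_nhds_unique h ((hp f).congr fun U => ?_)
    simp [dualStar_apply, hbs]
  · refine tendsto_nhds_unique (hp _) (tendsto_const_nhds.congr' ?_)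
    refine ((eventually_le_atBot (⟨⟨{y}ᶜ, isOpen_compl_singleton⟩, hy.symm⟩ :
        TopologicalSpace.OpenNhdsOf x)).filter_mono hl).mono fun U hU => ?_
    exact (hb0 U y fun h => hU h rfl).symm

theorem discreteTopology_of_isOpenProjection
    (h : ∀ p : Bidual C₀(Ω, ℂ), IsStarProjection p → IsOpenProjection p) : DiscreteTopology Ω := by
  refine discreteTopology_iff_isOpen_singleton.2 fun x => ?_
  obtain ⟨p, hp, hx, hne⟩ := exists_isStarProjection_atom x
  exact isOpen_singleton_of_isOpenProjection (h p hp) hx hne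

end Atom

theorem isClosed_range_incl {A : Type*} [NonUnitalCStarAlgebra A] :
    IsClosed (Set.range (incl : A → Bidual A)) :=
  (incl (A := A)).isometry.isUniformInducing.isComplete_range.isClosed

/-! ### Discrete spaces: the duality of `c₀`, `ℓ¹` and `ℓ^∞`. -/

section Discrete

variable {Ω : Type*} [TopologicalSpace Ω] [DiscreteTopology Ω]

theorem finite_le_norm (a : C₀(Ω, ℂ)) {ε : ℝ} (hε : 0 < ε) : {x | ε ≤ ‖a x‖}.Finite := by
  have h := (NormedAddGroup.tendsto_nhds_zero.1 a.zero_at_infty') ε hε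
  rw [cocompact_eq_cofinite, eventually_cofinite] at h
  refine h.subset fun x hx => ?_
  exact not_lt.2 hx

theorem countable_support (a : C₀(Ω, ℂ)) : (Function.support a).Countable := by
  have h : Function.support a ⊆ ⋃ n : ℕ, {x | 1 / ((n : ℝ) + 1) ≤ ‖a x‖} := by
    intro x hx
    obtain ⟨n, hn⟩ := exists_nat_one_div_lt (norm_pos_iff.2 hx)
    exact Set.mem_iUnion.2 ⟨n, hn.le⟩
  exact (Set.countable_iUnion fun n => (finite_le_norm a (by positivity)).countable).mono h

/-- The indicator function of a point of a discrete space. -/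
noncomputable def single (x : Ω) : C₀(Ω, ℂ) where
  toFun := Set.indicator {x} 1
  continuous_toFun := continuous_of_discreteTopology
  zero_at_infty' := by
    rw [cocompact_eq_cofinite]
    refine tendsto_const_nhds.congr' ?_
    filter_upwards [(Set.finite_singleton x).compl_mem_cofinite] with y hy
    exact (Set.indicator_of_notMem hy _).symm

theorem sum_smul_single_apply (s : Finset Ω) (c : Ω → ℂ) (y : Ω) [Decidable (y ∈ s)] :
    (∑ x ∈ s, c x • single x) y = if y ∈ s then c y else 0 := by
  classical
  change evalAt y _ = _
  rw [map_sum]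
  have h (x : Ω) : evalAt y (c x • single x) = if y = x then c x else 0 := by
    change c x * Set.indicator {x} 1 y = _
    simp [Set.indicator_apply]
  simp [h]

theorem single_apply_self (x : Ω) : single x x = 1 := by
  change Set.indicator {x} 1 x = (1 : ℂ)
  simp

theorem hasSum_smul_single (a : C₀(Ω, ℂ)) : HasSum (fun x => a x • single x) a := by
  classical
  rw [HasSum, SummationFilter.unconditional_filter, Metric.tendsto_atTop]
  intro ε hε
  refine ⟨(finite_le_norm a (half_pos hε)).toFinset, fun s hs => ?_⟩
  rw [dist_eq_norm]
  refine (norm_le_of_forall (half_pos hε).le fun y => ?_).trans_lt (half_lt_self hε)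
  rw [ZeroAtInftyContinuousMap.sub_apply, sum_smul_single_apply]
  split_ifs with hy
  · simp [(half_pos hε).le]
  · rw [zero_sub, norm_neg]
    refine le_of_not_ge fun h => hy (hs ?_)
    simpa using h

/-- Test `f` on a finite combination of indicators whose coefficients cancel the phases of `f
(single x)`; its norm is at most 1. -/
theorem sum_norm_apply_single_le (f : StrongDual ℂ C₀(Ω, ℂ)) (s : Finset Ω) :
    ∑ x ∈ s, ‖f (single x)‖ ≤ ‖f‖ := by
  classical
  let u : Ω → ℂ := fun x => star (f (single x)) / (‖f (single x)‖ : ℂ)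
  have hu (x) : ‖u x‖ ≤ 1 := by
    simp only [u, norm_div, norm_star, Complex.norm_real, norm_norm]
    exact div_self_le_one _
  have huf (x) : u x * f (single x) = (‖f (single x)‖ : ℂ) := by
    by_cases h : f (single x) = 0
    · simp [h]
    · have h' : (‖f (single x)‖ : ℂ) ≠ 0 := by simpa using h
      simp only [u]
      rw [div_mul_eq_mul_div, div_eq_iff h', RCLike.star_def, RCLike.conj_mul, sq]
      rfl
  have hn : ‖∑ x ∈ s, u x • single x‖ ≤ 1 := by
    refine norm_le_of_forall zero_le_one fun y => ?_
    rw [sum_smul_single_apply]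
    split_ifs
    · exact hu y
    · simp
  have h := f.le_opNorm_of_le hn
  rw [map_sum] at h
  simp only [map_smul, smul_eq_mul, huf] at h
  rw [← Complex.ofReal_sum, Complex.norm_real, mul_one] at h
  exact (le_abs_self _).trans h

theorem summable_norm_apply_single (f : StrongDual ℂ C₀(Ω, ℂ)) :
    Summable fun x => ‖f (single x)‖ :=
  summable_of_sum_le (fun _ => norm_nonneg _) (sum_norm_apply_single_le f)

theorem tsum_norm_apply_single_le (f : StrongDual ℂ C₀(Ω, ℂ)) :
    ∑' x, ‖f (single x)‖ ≤ ‖f‖ :=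
  (summable_norm_apply_single f).tsum_le_of_sum_le (sum_norm_apply_single_le f)

/-- A functional on `C₀(Ω, ℂ)`, for discrete `Ω`, is a norm convergent sum of evaluations. -/
theorem hasSum_smul_evalAt (f : StrongDual ℂ C₀(Ω, ℂ)) :
    HasSum (fun x => f (single x) • evalAt x) f := by
  have hs : Summable fun x => f (single x) • evalAt x := by
    refine Summable.of_norm_bounded (E := StrongDual ℂ C₀(Ω, ℂ))
      (summable_norm_apply_single f) fun x => ?_
    exact (ContinuousLinearMap.opNorm_smul_le (f (single x)) (evalAt x)).trans
      (mul_le_of_le_one_right (norm_nonneg _) (norm_evalAt_le x))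
  convert hs.hasSum
  ext a
  -- The sum is identified with `f` on each `a` by expanding `a` in indicators.
  have h1 := (hasSum_smul_single a).mapL f
  have h2 : HasSum (fun x => f (single x) * a x) ((∑' x, f (single x) • evalAt x) a) :=
    hs.hasSum.mapL (ContinuousLinearMap.apply ℂ ℂ a)
  refine h1.unique ?_
  simpa only [map_smul, smul_eq_mul, mul_comm] using h2


theorem hasSum_mul_evalAt (F : Bidual C₀(Ω, ℂ)) (f : StrongDual ℂ C₀(Ω, ℂ)) :
    HasSum (fun x => f (single x) * F (evalAt x)) (F f) := by
  simpa using (hasSum_smul_evalAt f).mapL F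

theorem bidual_ext {F G : Bidual C₀(Ω, ℂ)} (h : ∀ x, F (evalAt x) = G (evalAt x)) : F = G := by
  ext f
  refine (hasSum_mul_evalAt F f).unique ?_
  simpa only [h] using hasSum_mul_evalAt G f

theorem summable_norm_mul (f : StrongDual ℂ C₀(Ω, ℂ)) {φ : Ω → ℂ} {C : ℝ}
    (hφ : ∀ x, ‖φ x‖ ≤ C) : Summable fun x => ‖f (single x) * φ x‖ := by
  refine Summable.of_nonneg_of_le (fun _ => norm_nonneg _) (fun x => ?_)
    ((summable_norm_apply_single f).mul_right C)
  rw [norm_mul]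
  exact mul_le_mul_of_nonneg_left (hφ x) (norm_nonneg _)

theorem norm_tsum_mul_le (f : StrongDual ℂ C₀(Ω, ℂ)) {φ : Ω → ℂ} {C : ℝ} (hC : 0 ≤ C)
    (hφ : ∀ x, ‖φ x‖ ≤ C) : ‖∑' x, f (single x) * φ x‖ ≤ C * ‖f‖ := by
  have h := summable_norm_mul f hφ
  calc ‖∑' x, f (single x) * φ x‖ ≤ ∑' x, ‖f (single x) * φ x‖ := norm_tsum_le_tsum_norm h
    _ ≤ ∑' x, ‖f (single x)‖ * C := by
      refine h.tsum_le_tsum (fun x => ?_) ((summable_norm_apply_single f).mul_right C)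
      rw [norm_mul]
      exact mul_le_mul_of_nonneg_left (hφ x) (norm_nonneg _)
    _ = C * ∑' x, ‖f (single x)‖ := by rw [tsum_mul_right, mul_comm]
    _ ≤ C * ‖f‖ := mul_le_mul_of_nonneg_left (tsum_norm_apply_single_le f) hC

theorem norm_bidual_le {F : Bidual C₀(Ω, ℂ)} {C : ℝ} (hC : 0 ≤ C)
    (h : ∀ x, ‖F (evalAt x)‖ ≤ C) : ‖F‖ ≤ C := by
  refine F.opNorm_le_bound hC fun f => ?_
  rw [← (hasSum_mul_evalAt F f).tsum_eq]
  exact norm_tsum_mul_le f hC h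

/-- A bounded function pairs with the absolutely summable coefficients `f (single x)`. -/
theorem exists_bidual_evalAt_eq {φ : Ω → ℂ} {C : ℝ} (hC : 0 ≤ C) (hφ : ∀ x, ‖φ x‖ ≤ C) :
    ∃ F : Bidual C₀(Ω, ℂ), ∀ x, F (evalAt x) = φ x := by
  refine ⟨LinearMap.mkContinuous
    { toFun := fun f => ∑' x, f (single x) * φ x
      map_add' := fun f g => ?_
      map_smul' := fun c f => ?_ } C (fun f => norm_tsum_mul_le f hC hφ), fun x => ?_⟩
  · simp only [add_apply, add_mul]
    exact (summable_norm_mul f hφ).of_norm.tsum_add (summable_norm_mul g hφ).of_norm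
  · simp only [smul_apply, smul_eq_mul, mul_assoc, RingHom.id_apply]
    exact tsum_mul_left
  · change ∑' y, evalAt x (single y) * φ y = φ x
    rw [tsum_eq_single x]
    · rw [evalAt_apply, single_apply_self, one_mul]
    · intro y hy
      have : single y x = 0 := Set.indicator_of_notMem (by simpa using hy.symm) _
      rw [evalAt_apply, this, zero_mul]

theorem isOpenProjection_of_isStarProjection {p : Bidual C₀(Ω, ℂ)} (hp : IsStarProjection p) :
    IsOpenProjection p := by
  classical
  have hmul (x : Ω) : p (evalAt x) * p (evalAt x) = p (evalAt x) := by
    rw [← mul_evalAt, hp.isIdempotentElem.eq]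
  have hstar (x : Ω) : star (p (evalAt x)) = p (evalAt x) := by
    rw [← star_evalAt, hp.isSelfAdjoint.star_eq]
  have hpos (s : Finset Ω) : IsPos (∑ x ∈ s, p (evalAt x) • single x) := by
    -- The values of `p` are self-adjoint idempotent scalars, so each partial sum equals its own
    -- `star b * b`.
    refine ⟨∑ x ∈ s, p (evalAt x) • single x, ?_⟩
    ext y
    rw [ZeroAtInftyContinuousMap.mul_apply, ZeroAtInftyContinuousMap.star_apply,
      sum_smul_single_apply]
    split_ifs
    · rw [hstar, hmul]
    · simp
  refine ⟨hp, Finset Ω, inferInstance, inferInstance, inferInstance,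
    fun s => ∑ x ∈ s, p (evalAt x) • single x, hpos, fun s t hst => ?_, ?_⟩
  · beta_reduce
    rw [← Finset.sum_sdiff hst, add_sub_cancel_right]
    exact hpos _
  · refine tendsto_iff_forall_eval_tendsto_topDualPairing.2 fun f => ?_
    have h := hasSum_mul_evalAt p f
    rw [HasSum, SummationFilter.unconditional_filter] at h
    refine h.congr fun s => ?_
    change _ = f (∑ x ∈ s, p (evalAt x) • single x)
    simp [mul_comm]

/-! ### Multipliers of `C₀(Ω, ℂ)` as bounded functions. -/

/-- Pointwise multiplication by the bounded function `x ↦ F (evalAt x)`, for `F` in the bidual. -/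
noncomputable def pointwiseMul (F : Bidual C₀(Ω, ℂ)) : C₀(Ω, ℂ) →L[ℂ] C₀(Ω, ℂ) :=
  LinearMap.mkContinuous
    { toFun := fun a =>
        { toFun := fun x => F (evalAt x) * a x
          continuous_toFun := continuous_of_discreteTopology
          zero_at_infty' := by
            refine squeeze_zero_norm (a := fun x => ‖F‖ * ‖a x‖) (fun x => ?_) ?_
            · rw [norm_mul]
              exact mul_le_mul_of_nonneg_right (norm_evalAt_le_norm F x) (norm_nonneg _)
            · simpa using (a.zero_at_infty'.norm).const_mul ‖F‖ }
      map_add' := fun a b => by ext x; exact mul_add _ _ _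
      map_smul' := fun c a => by ext x; exact mul_left_comm _ _ _ } ‖F‖
    (fun a => norm_le_of_forall (by positivity) fun x => by
      refine (norm_mul_le _ _).trans ?_
      exact mul_le_mul (norm_evalAt_le_norm F x) (norm_apply_le a x) (norm_nonneg _)
        F.opNorm_nonneg)

theorem pointwiseMul_apply (F : Bidual C₀(Ω, ℂ)) (a : C₀(Ω, ℂ)) (x : Ω) :
    pointwiseMul F a x = F (evalAt x) * a x := rfl

theorem norm_pointwiseMul_le (F : Bidual C₀(Ω, ℂ)) : ‖pointwiseMul F‖ ≤ ‖F‖ :=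
  LinearMap.mkContinuous_norm_le _ (norm_nonneg F) _

theorem mul_incl (F : Bidual C₀(Ω, ℂ)) (a : C₀(Ω, ℂ)) : F * incl a = incl (pointwiseMul F a) :=
  bidual_ext fun x => by
    rw [mul_evalAt, incl_evalAt, incl_evalAt, pointwiseMul_apply]

theorem incl_mul_bidual (F : Bidual C₀(Ω, ℂ)) (a : C₀(Ω, ℂ)) :
    incl a * F = incl (pointwiseMul F a) :=
  bidual_ext fun x => by
    rw [mul_evalAt, incl_evalAt, incl_evalAt, pointwiseMul_apply, mul_comm]

theorem isIdealInBidual : IsIdealInBidual C₀(Ω, ℂ) :=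
  ⟨isClosed_range_incl, fun F a => ⟨⟨_, (mul_incl F a).symm⟩, ⟨_, (incl_mul_bidual F a).symm⟩⟩⟩

/-- The multiplier of `C₀(Ω, ℂ)` given by pointwise multiplication with `x ↦ F (evalAt x)`. -/
noncomputable def toMultiplier (F : Bidual C₀(Ω, ℂ)) : 𝓜(ℂ, C₀(Ω, ℂ)) where
  fst := pointwiseMul F
  snd := pointwiseMul F
  central := fun a b => by
    ext x
    change F (evalAt x) * a x * b x = a x * (F (evalAt x) * b x)
    ring

/-- Centrality against `single x`, read off at `x`, leaves one scalar per point; the same scalars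
determine both components of `m`. -/
theorem multiplier_fst_apply (m : 𝓜(ℂ, C₀(Ω, ℂ))) (a : C₀(Ω, ℂ)) (x : Ω) :
    m.fst a x = m.snd (single x) x * a x := by
  have h := DFunLike.congr_fun (m.central (single x) a) x
  rw [ZeroAtInftyContinuousMap.mul_apply, ZeroAtInftyContinuousMap.mul_apply,
    single_apply_self, one_mul] at h
  exact h.symm

theorem multiplier_snd_apply (m : 𝓜(ℂ, C₀(Ω, ℂ))) (a : C₀(Ω, ℂ)) (x : Ω) :
    m.snd a x = m.snd (single x) x * a x := by
  have h := DFunLike.congr_fun (m.central a (single x)) x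
  rw [ZeroAtInftyContinuousMap.mul_apply, ZeroAtInftyContinuousMap.mul_apply,
    single_apply_self, mul_one, multiplier_fst_apply, single_apply_self, mul_one] at h
  rw [h, mul_comm]

theorem norm_single_le (x : Ω) : ‖single x‖ ≤ 1 := by
  refine norm_le_of_forall zero_le_one fun y => ?_
  exact (norm_indicator_le_norm_self 1 y).trans (by simp)

theorem bijective_toMultiplier :
    Function.Bijective (toMultiplier : Bidual C₀(Ω, ℂ) → 𝓜(ℂ, C₀(Ω, ℂ))) := by
  refine ⟨fun F G h => bidual_ext fun x => ?_, fun m => ?_⟩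
  · have h' : pointwiseMul F (single x) x = pointwiseMul G (single x) x :=
      congrArg (fun m : 𝓜(ℂ, C₀(Ω, ℂ)) => m.fst (single x) x) h
    simpa [pointwiseMul_apply, single_apply_self] using h'
  · obtain ⟨F, hF⟩ := exists_bidual_evalAt_eq (φ := fun x => m.snd (single x) x) (norm_nonneg m.snd)
      fun x => (norm_apply_le _ x).trans (by
        simpa using m.snd.le_opNorm_of_le (norm_single_le x))
    refine ⟨F, DoubleCentralizer.ext _ _ _ _ (Prod.ext ?_ ?_)⟩
    · ext a x
      change F (evalAt x) * a x = m.fst a x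
      rw [hF]
      exact (multiplier_fst_apply m a x).symm
    · ext a x
      change F (evalAt x) * a x = m.snd a x
      rw [hF]
      exact (multiplier_snd_apply m a x).symm

/-- Applying the multiplier to `single x` recovers `F (evalAt x)`, and these values control `‖F‖`.
-/
theorem norm_toMultiplier (F : Bidual C₀(Ω, ℂ)) : ‖toMultiplier F‖ = ‖F‖ := by
  rw [← DoubleCentralizer.norm_fst]
  refine le_antisymm (norm_pointwiseMul_le F) (norm_bidual_le (norm_nonneg _) fun x => ?_)
  have h := (norm_apply_le _ x).trans ((pointwiseMul F).le_opNorm_of_le (norm_single_le x))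
  rwa [pointwiseMul_apply, single_apply_self, mul_one, mul_one] at h

theorem toMultiplier_ext {F : Bidual C₀(Ω, ℂ)} {m : 𝓜(ℂ, C₀(Ω, ℂ))}
    (h : ∀ a x, F (evalAt x) * a x = m.fst a x) (h' : ∀ a x, F (evalAt x) * a x = m.snd a x) :
    toMultiplier F = m :=
  DoubleCentralizer.ext _ _ _ _
    (Prod.ext (ContinuousLinearMap.ext fun a => ZeroAtInftyContinuousMap.ext (h a))
      (ContinuousLinearMap.ext fun a => ZeroAtInftyContinuousMap.ext (h' a)))

/-- For discrete `Ω`, the bidual of `C₀(Ω, ℂ)` is its multiplier algebra. -/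
noncomputable def multiplierEquiv : Bidual C₀(Ω, ℂ) ≃⋆ₐ[ℂ] 𝓜(ℂ, C₀(Ω, ℂ)) where
  __ := Equiv.ofBijective _ bijective_toMultiplier
  map_mul' := fun F G => by
    refine toMultiplier_ext (fun a x => ?_) fun a x => ?_
    · rw [mul_evalAt, mul_assoc]; rfl
    -- Second components compose in the opposite order, hence the commutation.
    · rw [mul_evalAt, mul_comm (F _), mul_assoc]; rfl
  map_add' := fun F G => toMultiplier_ext (fun a x => add_mul _ _ _) fun a x => add_mul _ _ _
  map_star' := fun F => by
    -- The star of a multiplier swaps its components; here they coincide, so one identity serves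
    -- both.
    have h (a : C₀(Ω, ℂ)) (x : Ω) :
        (star F) (evalAt x) * a x = star (pointwiseMul F (star a) x) := by
      rw [star_evalAt, pointwiseMul_apply, star_mul', ZeroAtInftyContinuousMap.star_apply,
        star_star]
    exact toMultiplier_ext h h
  map_smul' := fun c F => toMultiplier_ext (fun a x => mul_assoc _ _ _) fun a x => mul_assoc _ _ _

theorem bidualIsMultiplierAlgebra : BidualIsMultiplierAlgebra C₀(Ω, ℂ) := by
  refine ⟨multiplierEquiv, Isometry.of_dist_eq fun F G => ?_, fun a => ?_⟩
  · have h : toMultiplier (F - G) = toMultiplier F - toMultiplier G :=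
      toMultiplier_ext (fun a x => sub_mul _ _ _) fun a x => sub_mul _ _ _
    rw [dist_eq_norm, dist_eq_norm]
    exact (congrArg norm h.symm).trans (norm_toMultiplier (F - G))
  · exact toMultiplier_ext (fun b x => rfl) fun b x => mul_comm _ _

end Discrete

/-! ### Compact spaces: reduction to `ℂⁿ`. -/

section Compact

variable {Ω : Type*} [TopologicalSpace Ω] [CompactSpace Ω]

/-- Continuous functions on a discrete compact space with `n` points are vectors in `ℂⁿ`. -/
noncomputable def continuousMapEquivFin [DiscreteTopology Ω] {n : ℕ} (e : Ω ≃ Fin n) : C(Ω, ℂ) ≃⋆ₐ[ℂ] (Fin n → ℂ) where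
  toFun := fun f i => f (e.symm i)
  invFun := fun v => ⟨fun x => v (e x), continuous_of_discreteTopology⟩
  left_inv := fun f => by ext x; simp
  right_inv := fun v => by ext i; simp
  map_mul' := fun _ _ => rfl
  map_add' := fun _ _ => rfl
  map_star' := fun _ => rfl
  map_smul' := fun _ _ => rfl

theorem isometry_continuousMapEquivFin [DiscreteTopology Ω] {n : ℕ} (e : Ω ≃ Fin n) :
    Isometry (continuousMapEquivFin e) := by
  refine AddMonoidHomClass.isometry_of_norm _ fun f => le_antisymm ?_ ?_
  · exact (pi_norm_le_iff_of_nonneg (norm_nonneg f)).2 fun i => f.norm_coe_le_norm _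
  · refine (ContinuousMap.norm_le f (norm_nonneg _)).2 fun x => ?_
    have h := norm_le_pi_norm (continuousMapEquivFin e f) (e x)
    rwa [show continuousMapEquivFin e f (e x) = f x from congrArg f (e.symm_apply_apply x)] at h

/-- On a compact space all continuous functions vanish at infinity. -/
noncomputable def zeroAtInftyEquivContinuousMap : C₀(Ω, ℂ) ≃⋆ₐ[ℂ] C(Ω, ℂ) where
  __ := (ZeroAtInftyContinuousMap.ContinuousMap.liftZeroAtInfty (α := Ω) (β := ℂ)).symm
  map_mul' := fun _ _ => rfl
  map_add' := fun _ _ => rfl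
  map_star' := fun _ => rfl
  map_smul' := fun _ _ => rfl

theorem isometry_zeroAtInftyEquivContinuousMap :
    Isometry (zeroAtInftyEquivContinuousMap (Ω := Ω)) :=
  AddMonoidHomClass.isometry_of_norm _ fun f => le_antisymm
    ((ContinuousMap.norm_le _ (norm_nonneg f)).2 fun x => norm_apply_le f x)
    (norm_le_of_forall (norm_nonneg _) fun x =>
      (zeroAtInftyEquivContinuousMap f).norm_coe_le_norm x)

end Compact

end CStarBidual

theorem mainTheorem4 {Ω : Type*} [TopologicalSpace Ω] [LocallyCompactSpace Ω] [T2Space Ω] :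
    ((∀ p : CStarBidual.Bidual C₀(Ω, ℂ), IsStarProjection p → CStarBidual.IsOpenProjection p) ↔
        DiscreteTopology Ω) ∧
      (DiscreteTopology Ω →
        (∀ f : C₀(Ω, ℂ), (Function.support f).Countable) ∧
        CStarBidual.IsIdealInBidual C₀(Ω, ℂ) ∧
        CStarBidual.BidualIsMultiplierAlgebra C₀(Ω, ℂ) ∧
        (∀ _ : CompactSpace Ω,
          ∃ n : ℕ,
            (∃ e : C₀(Ω, ℂ) ≃⋆ₐ[ℂ] (Fin n → ℂ), Isometry e) ∧
            (∃ e : C(Ω, ℂ) ≃⋆ₐ[ℂ] (Fin n → ℂ), Isometry e))) := by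
  refine ⟨⟨CStarBidual.discreteTopology_of_isOpenProjection,
    fun _ _ => CStarBidual.isOpenProjection_of_isStarProjection⟩, fun _ =>
    ⟨CStarBidual.countable_support, CStarBidual.isIdealInBidual,
      CStarBidual.bidualIsMultiplierAlgebra, fun _ => ?_⟩⟩
  have : Finite Ω := finite_of_compact_of_discrete
  obtain ⟨n, ⟨e⟩⟩ := Finite.exists_equiv_fin Ω
  exact ⟨n, ⟨CStarBidual.zeroAtInftyEquivContinuousMap.trans (CStarBidual.continuousMapEquivFin e),
      (CStarBidual.isometry_continuousMapEquivFin e).comp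
        CStarBidual.isometry_zeroAtInftyEquivContinuousMap⟩,
    ⟨CStarBidual.continuousMapEquivFin e, CStarBidual.isometry_continuousMapEquivFin e⟩⟩
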